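/- Consider randomized query algorithms that access a finite simple graph $G=(V,E)$ only through (1) random vertex queries, each returning an independent uniformly random vertex of $V$, (2) random edge queries, each returning an independent uniformly random edge of $E$, and (3) degree queries, which return $\deg(v)$ for a vertex $v\in V$ that was returned by an earlier random vertex query or as an endpoint by an earlier random edge query. The algorithm may choose its queries adaptively and at random. It does not know $V$, $n=|V|$ or $m=|E|$ in advance, and vertices are presented to it under arbitrary distinct names. Theorem. There are an absolute constant $C>0$ and, for each $0<\varepsilon<1$, such an algorithm $A_\varepsilon$ with the following property. For every finite graph $G$ with $n$ vertices and $m\ge 1$ edges, whatever the names of its vertices, $A_\varepsilon$ stops and returns, with probability at least $2/3$, a number $\hat d$ with $(1-\varepsilon)d\le\hat d\le(1+\varepsilon)d$, where $d=2m/n$ is the average degree; and the expected number of queries that $A_\varepsilon$ makes (queries of all three kinds are counted) is at most $$C\left(\frac{m\,\log\log d}{n'\,\varepsilon^{2}}+\frac{n}{n'\,\varepsilon^{2}}\right),$$ where $n'$ is the number of non-isolated vertices of $G$ (those of nonzero degree) and $\log\log d$ is read as $0$ when $d\le e$. -/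

import Mathlib

open scoped ENNReal

universe u

namespace EdgeCount

/-- The three kinds of queries. Vertices are known to an algorithm only through their names,
which are natural numbers. -/
inductive Query : Type
  | randomVertex : Query
  | randomEdge : Query
  | degree (x : ℕ) : Query

/-- A query together with its answer, as an algorithm sees it: the name of a sampled vertex, the
unordered pair of the names of the endpoints of a sampled edge, or the degree `k` of the vertex
with name `x`. -/
inductive Event : Type
  | vertex (x : ℕ) : Event
  | edge (e : Sym2 ℕ) : Event
  | degree (x k : ℕ) : Event

/-- The names of the vertices returned by a sampling query. -/
def Event.revealed : Event → Set ℕ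
  | .vertex x => {x}
  | .edge e => {x | x ∈ e}
  | .degree _ _ => ∅

/-- The queries made so far and their answers, the most recent one first. -/
abbrev Transcript : Type := List Event

/-- The names that the sampling queries of a transcript have returned. -/
def Transcript.seen (h : Transcript) : Set ℕ := {x | ∃ e ∈ h, x ∈ e.revealed}

/-- An adaptive randomized query algorithm. Given everything seen so far, it chooses at random
either the next query (`Sum.inl`) or to stop with a real number as its output (`Sum.inr`). It knows
nothing about the graph except for the transcript, and it asks for the degree of a vertex only
if that vertex was returned by an earlier sampling query. -/
structure Algorithm : Type where
  next : Transcript → PMF (Query ⊕ ℝ)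
  legal : ∀ (h : Transcript) (x : ℕ), Sum.inl (Query.degree x) ∈ (next h).support → x ∈ h.seen

/-- The state of an execution: the transcript, and the output once the algorithm has stopped. -/
abbrev State : Type := Transcript × Option ℝ

section Execution

variable {V : Type u} [Fintype V] [DecidableEq V] [Nonempty V]
  (G : SimpleGraph V) [DecidableRel G.Adj] (name : V ↪ ℕ) (hE : G.edgeFinset.Nonempty)

open Classical in
/-- The degree of the vertex with name `x` (the value `0` at a number that names no vertex is
never used, since algorithms query the degrees of returned vertices only). -/
noncomputable def degreeOfName (x : ℕ) : ℕ :=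
  if hx : ∃ v, name v = x then G.degree hx.choose else 0

/-- The random answer to a query: a uniformly random vertex, a uniformly random edge, or the degree
of the given vertex. -/
noncomputable def answer : Query → PMF Event
  | .randomVertex => (PMF.uniformOfFintype V).map fun v => Event.vertex (name v)
  | .randomEdge => (PMF.uniformOfFinset G.edgeFinset hE).map fun e => Event.edge (e.map name)
  | .degree x => PMF.pure (Event.degree x (degreeOfName G name x))

/-- One step of an execution. -/
noncomputable def step (A : Algorithm) : State → PMF State
  | (h, some r) => PMF.pure (h, some r)
  | (h, none) => (A.next h).bind fun a =>
      match a with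
      | Sum.inl q => (answer G name hE q).map fun e => (e :: h, none)
      | Sum.inr r => PMF.pure (h, some r)

/-- The law of the state after `t` steps. -/
noncomputable def run (A : Algorithm) : ℕ → PMF State
  | 0 => PMF.pure ([], none)
  | t + 1 => (run A t).bind (step G name hE A)

/-- The expected total number of queries, of all three kinds: the limit of the expected number
of queries made within the first `t` steps, which is nondecreasing in `t`. -/
noncomputable def expectedQueries (A : Algorithm) : ℝ≥0∞ :=
  ⨆ t : ℕ, ∑' s : State, run G name hE A t s * (s.1.length : ℝ≥0∞)

/-- The probability that the algorithm stops with an output in `S`: the limit of the probability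
that it does so within the first `t` steps, which is nondecreasing in `t`. -/
noncomputable def outputProb (A : Algorithm) (S : Set ℝ) : ℝ≥0∞ :=
  ⨆ t : ℕ, (run G name hE A t).toOuterMeasure {s : State | ∃ r ∈ S, s.2 = some r}

end Execution

section Parameters

variable {V : Type u} [Fintype V] [DecidableEq V] (G : SimpleGraph V) [DecidableRel G.Adj]

/-- The average degree `2m/n`. -/
noncomputable def avgDegree : ℝ := 2 * (G.edgeFinset.card : ℝ) / (Fintype.card V : ℝ)

/-- The number of vertices of nonzero degree. -/
def numNonIsolated : ℕ := (Finset.univ.filter fun v : V => G.degree v ≠ 0).card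

end Parameters

/-- The set of `(1 ± ε)`-approximations of `x`. -/
def approximations (ε x : ℝ) : Set ℝ := {y | (1 - ε) * x ≤ y ∧ y ≤ (1 + ε) * x}

/-- The iterated logarithm `log log x`, read as `0` for `x ≤ e`, where it would be
negative or undefined. -/
noncomputable def logLog (x : ℝ) : ℝ := Real.log (max 1 (Real.log (max 1 x)))

end EdgeCount

/-! The inverse degree of a random endpoint of a uniformly random edge has mean
`∑ (deg v / 2m) * (1 / deg v) = n' / 2m`, the sum running over the non-isolated vertices `v`, and
a uniformly random vertex is non-isolated with probability `n' / n`. Independent copies of these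
two `[0, 1]`-valued variables therefore need about `K * 2m / n'` and `K * n / n'` rounds to add up
to a threshold `K`, and the ratio of the two times estimates `2m / n`. For `K` of order `1 / ε²`,
Chebyshev's inequality shows that with probability at least `2 / 3` both times are accurate up to
factors `1 ± ε / 3`, and by Wald's identity the two times have mean at most `(K + 1) * 2m / n'` and
`(K + 1) * n / n'`. The resulting bound `O((m + n) / (n' ε²))` on the number of queries suffices:
either `log log d ≥ 1`, or `d` is bounded by a constant and then `m = O(n)`. -/

namespace EdgeCount

open MeasureTheory ProbabilityTheory Finset

section ReachTime

variable {K : ℝ} {x : ℕ → ℝ}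

open Classical in
/-- The number of times `t < T` at which the partial sum `x 0 + ⋯ + x (t - 1)` is below `K`. For
nonnegative `x` this is the first time at which the partial sums reach `K`, truncated at `T`. -/
noncomputable def reachTime (K : ℝ) (x : ℕ → ℝ) (T : ℕ) : ℕ :=
  Nat.count (fun t => ∑ i ∈ range t, x i < K) T

theorem reachTime_succ_of_lt {T : ℕ} (h : ∑ i ∈ range T, x i < K) :
    reachTime K x (T + 1) = reachTime K x T + 1 := by
  simp [reachTime, Nat.count_succ, h]

theorem reachTime_succ_of_le {T : ℕ} (h : K ≤ ∑ i ∈ range T, x i) :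
    reachTime K x (T + 1) = reachTime K x T := by
  simp [reachTime, Nat.count_succ, h]

theorem cast_reachTime (T : ℕ) :
    (reachTime K x T : ℝ) =
      ∑ t ∈ range T, (Set.Iio K).indicator (fun _ => (1 : ℝ)) (∑ i ∈ range t, x i) := by
  classical
  rw [reachTime, Nat.count_eq_card_filter_range, card_filter]
  push_cast
  exact sum_congr rfl fun t _ => by simp only [Set.indicator_apply, Set.mem_Iio]

theorem monotone_sum_range (h0 : ∀ i, 0 ≤ x i) : Monotone fun t => ∑ i ∈ range t, x i :=
  monotone_nat_of_le_succ fun t => by simpa [sum_range_succ] using h0 t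

theorem reachTime_le_of_le_sum (h0 : ∀ i, 0 ≤ x i) {t : ℕ} (h : K ≤ ∑ i ∈ range t, x i) (T : ℕ) :
    reachTime K x T ≤ t := by
  classical
  rw [reachTime, Nat.count_eq_card_filter_range, ← card_range t]
  refine card_le_card fun i hi => mem_range.2 ((monotone_sum_range h0).reflect_lt ?_)
  exact (mem_filter.1 hi).2.trans_le h

theorem lt_reachTime_of_sum_lt (h0 : ∀ i, 0 ≤ x i) {s T : ℕ} (hsT : s < T)
    (h : ∑ i ∈ range s, x i < K) : s < reachTime K x T := by
  classical
  rw [reachTime, Nat.count_eq_card_filter_range, ← Nat.succ_le_iff, ← card_range s.succ]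
  refine card_le_card fun i hi => mem_filter.2 ?_
  have his : i ≤ s := Nat.lt_succ_iff.1 (mem_range.1 hi)
  exact ⟨mem_range.2 (his.trans_lt hsT), (monotone_sum_range h0 his).trans_lt h⟩

theorem reachTime_le (T : ℕ) : reachTime K x T ≤ T :=
  Nat.count_le _

theorem sum_indicator_mul_le (hK : 0 ≤ K) (h01 : ∀ i, x i ∈ Set.Icc 0 1) (T : ℕ) :
    ∑ t ∈ range T, (Set.Iio K).indicator (fun _ => (1 : ℝ)) (∑ i ∈ range t, x i) * x t ≤
      K + 1 := by
  suffices h : ∑ t ∈ range T, (Set.Iio K).indicator (fun _ => (1 : ℝ)) (∑ i ∈ range t, x i) * x t ≤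
      min (∑ i ∈ range T, x i) (K + 1) from h.trans (min_le_right _ _)
  induction T with
  | zero => simp; linarith
  | succ T ih =>
    obtain ⟨ih_sum, ih_const⟩ := le_min_iff.1 ih
    obtain ⟨hx0, hx1⟩ := h01 T
    rw [sum_range_succ, sum_range_succ _ T, le_min_iff]
    by_cases h : ∑ i ∈ range T, x i < K
    · rw [Set.indicator_of_mem (Set.mem_Iio.2 h), one_mul]
      constructor <;> linarith
    · rw [Set.indicator_of_notMem (Set.notMem_Iio.2 (not_lt.1 h)), zero_mul]
      constructor <;> linarith

/-- The partial sums of `x` reach `K` within `T` steps, and the time at which they do so estimates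
`K / μ` with relative error at most `δ`. Used when `μ` is the common mean of the terms of a random
sequence `x`. -/
def ReachesNear (K δ μ : ℝ) (x : ℕ → ℝ) (T : ℕ) : Prop :=
  K ≤ ∑ i ∈ range T, x i ∧ |reachTime K x T * μ - K| ≤ δ * K

theorem reachesNear_of_sum_lt_of_le_sum (h0 : ∀ i, 0 ≤ x i) {δ μ : ℝ} (hμ : 0 ≤ μ) {s t T : ℕ}
    (hsT : s < T) (hs : (1 - δ) * K ≤ (s + 1) * μ) (hxs : ∑ i ∈ range s, x i < K)
    (htT : t ≤ T) (ht : t * μ ≤ (1 + δ) * K) (hxt : K ≤ ∑ i ∈ range t, x i) :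
    ReachesNear K δ μ x T := by
  have hlower : (s + 1 : ℝ) ≤ reachTime K x T := by
    exact_mod_cast lt_reachTime_of_sum_lt h0 hsT hxs
  have hupper : (reachTime K x T : ℝ) ≤ t := by
    exact_mod_cast reachTime_le_of_le_sum h0 hxt T
  refine ⟨hxt.trans (monotone_sum_range h0 htT), abs_le.2 ⟨?_, ?_⟩⟩
  · linarith [mul_le_mul_of_nonneg_right hlower hμ]
  · linarith [mul_le_mul_of_nonneg_right hupper hμ]

end ReachTime

section IndependentSums

variable {Ω : Type*} [MeasurableSpace Ω] {P : Measure Ω}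
  {X : ℕ → Ω → ℝ} {μ : ℝ}

theorem measurable_indicator_sum_lt (hX : ∀ i, Measurable (X i)) (K : ℝ) (t : ℕ) :
    Measurable fun ω => (Set.Iio K).indicator (fun _ => (1 : ℝ)) (∑ i ∈ range t, X i ω) :=
  (measurable_const.indicator measurableSet_Iio).comp (Finset.measurable_fun_sum _ fun i _ => hX i)

theorem measurable_reachTime (hX : ∀ i, Measurable (X i)) (K : ℝ) (T : ℕ) :
    Measurable fun ω => (reachTime K (X · ω) T : ℝ) := by
  simp only [cast_reachTime]
  exact Finset.measurable_fun_sum _ fun t _ => measurable_indicator_sum_lt hX K t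

theorem measurableSet_reachesNear (hX : ∀ i, Measurable (X i)) (K δ μ : ℝ) (T : ℕ) :
    MeasurableSet {ω | ReachesNear K δ μ (X · ω) T} :=
  (measurableSet_le measurable_const (Finset.measurable_fun_sum _ fun i _ => hX i)).inter
    (measurableSet_le (((measurable_reachTime hX K T).mul_const μ).sub_const K).abs
      measurable_const)

theorem integral_mul_of_indicator_sum_lt (hX : ∀ i, Measurable (X i)) (hindep : iIndepFun X P)
    (hμ : ∀ i, P[X i] = μ) (K : ℝ) (t : ℕ) :
    ∫ ω, (Set.Iio K).indicator (fun _ => (1 : ℝ)) (∑ i ∈ range t, X i ω) * X t ω ∂P =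
      (∫ ω, (Set.Iio K).indicator (fun _ => (1 : ℝ)) (∑ i ∈ range t, X i ω) ∂P) * μ := by
  have hind : IndepFun (fun ω => ∑ i ∈ range t, X i ω) (X t) P := by
    simpa only [Finset.sum_fn] using hindep.indepFun_finsetSum_of_notMem hX notMem_range_self
  have hbelow : Measurable ((Set.Iio K).indicator fun _ => (1 : ℝ)) :=
    measurable_const.indicator measurableSet_Iio
  rw [← hμ t]
  exact (hind.comp hbelow measurable_id).integral_fun_mul_eq_mul_integral
    (measurable_indicator_sum_lt hX K t).aestronglyMeasurable (hX t).aestronglyMeasurable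

variable [IsProbabilityMeasure P]

theorem integrable_of_mem_Icc {Y : Ω → ℝ} (hY : Measurable Y) {a b : ℝ}
    (hab : ∀ ω, Y ω ∈ Set.Icc a b) : Integrable Y P :=
  .of_mem_Icc a b hY.aemeasurable (ae_of_all _ hab)

theorem integrable_reachTime (hX : ∀ i, Measurable (X i)) (K : ℝ) (T : ℕ) :
    Integrable (fun ω => (reachTime K (X · ω) T : ℝ)) P :=
  integrable_of_mem_Icc (measurable_reachTime hX K T) fun _ =>
    ⟨Nat.cast_nonneg _, Nat.cast_le.2 (reachTime_le T)⟩

/-- **Wald's identity** for the time at which the partial sums reach `K`, which they overshoot by at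
most `1`. -/
theorem integral_reachTime_mul_le (hX : ∀ i, Measurable (X i)) (hindep : iIndepFun X P)
    (h01 : ∀ i ω, X i ω ∈ Set.Icc 0 1) (hμ : ∀ i, P[X i] = μ) {K : ℝ} (hK : 0 ≤ K) (T : ℕ) :
    (∫ ω, (reachTime K (X · ω) T : ℝ) ∂P) * μ ≤ K + 1 := by
  have hbelow : ∀ s : ℝ, (Set.Iio K).indicator (fun _ => (1 : ℝ)) s ∈ Set.Icc 0 1 := fun s =>
    ⟨Set.indicator_nonneg (fun _ _ => zero_le_one) s, Set.indicator_le_self' (by simp) s⟩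
  have hint : ∀ t, Integrable
      (fun ω => (Set.Iio K).indicator (fun _ => (1 : ℝ)) (∑ i ∈ range t, X i ω) * X t ω) P :=
    fun t => integrable_of_mem_Icc ((measurable_indicator_sum_lt hX K t).mul (hX t)) fun ω =>
      unitInterval.mul_mem (hbelow _) (h01 t ω)
  calc (∫ ω, (reachTime K (X · ω) T : ℝ) ∂P) * μ
      = ∫ ω, ∑ t ∈ range T,
          (Set.Iio K).indicator (fun _ => (1 : ℝ)) (∑ i ∈ range t, X i ω) * X t ω ∂P := by
        simp only [cast_reachTime]
        rw [integral_finsetSum _ fun t _ => integrable_of_mem_Icc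
            (measurable_indicator_sum_lt hX K t) fun ω => hbelow _,
          integral_finsetSum _ fun t _ => hint t, sum_mul]
        exact sum_congr rfl fun t _ => (integral_mul_of_indicator_sum_lt hX hindep hμ K t).symm
    _ ≤ ∫ _, K + 1 ∂P :=
        integral_mono (integrable_finsetSum _ fun t _ => hint t) (integrable_const _)
          fun ω => sum_indicator_mul_le hK (fun i => h01 i ω) T
    _ = K + 1 := by simp

theorem measureReal_le_abs_sum_sub_le (hX : ∀ i, Measurable (X i)) (hindep : iIndepFun X P)
    (h01 : ∀ i ω, X i ω ∈ Set.Icc 0 1) (hμ : ∀ i, P[X i] = μ) (t : ℕ) {c : ℝ} (hc : 0 < c) :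
    P.real {ω | c ≤ |∑ i ∈ range t, X i ω - t * μ|} ≤ t * μ / c ^ 2 := by
  have hLp : ∀ i, MemLp (X i) 2 P := fun i =>
    memLp_of_bounded (ae_of_all _ (h01 i)) (hX i).aestronglyMeasurable 2
  have hmean : P[fun ω => ∑ i ∈ range t, X i ω] = t * μ := by
    rw [integral_finsetSum _ fun i _ => (hLp i).integrable (by norm_num)]
    simp [hμ]
  have hvar : Var[fun ω => ∑ i ∈ range t, X i ω; P] ≤ t * μ := by
    rw [← Finset.sum_fn, IndepFun.variance_sum (fun i _ => hLp i)
      fun i _ j _ hij => hindep.indepFun hij]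
    refine (sum_le_card_nsmul _ _ μ fun i _ => ?_).trans_eq (by simp)
    refine (variance_le_sub_mul_sub (ae_of_all _ (h01 i)) (hX i).aemeasurable).trans ?_
    rw [hμ i]
    nlinarith [sq_nonneg μ]
  have hcheb := meas_ge_le_variance_div_sq (memLp_finsetSum (range t) fun i _ => hLp i) hc
  rw [hmean] at hcheb
  refine (ENNReal.toReal_le_of_le_ofReal (div_nonneg (variance_nonneg _ _) (sq_nonneg c))
    hcheb).trans ?_
  gcongr

theorem measureReal_sum_lt_le (hX : ∀ i, Measurable (X i)) (hindep : iIndepFun X P)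
    (h01 : ∀ i ω, X i ω ∈ Set.Icc 0 1) (hμ : ∀ i, P[X i] = μ) {K δ : ℝ} (hK : 0 < K) (hδ : 0 < δ)
    (hδ1 : δ ≤ 1) {t : ℕ} (hKt : (1 + δ / 2) * K ≤ t * μ) (htK : t * μ ≤ (1 + δ) * K) :
    P.real {ω | ∑ i ∈ range t, X i ω < K} ≤ 8 / (δ ^ 2 * K) := by
  calc P.real {ω | ∑ i ∈ range t, X i ω < K}
      ≤ P.real {ω | δ / 2 * K ≤ |∑ i ∈ range t, X i ω - t * μ|} :=
        measureReal_mono fun ω (hω : _ < K) =>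
          show δ / 2 * K ≤ _ from le_abs.2 (.inr (by linarith))
    _ ≤ t * μ / (δ / 2 * K) ^ 2 := measureReal_le_abs_sum_sub_le hX hindep h01 hμ t (by positivity)
    _ ≤ 2 * K / (δ / 2 * K) ^ 2 := by
        have : t * μ ≤ 2 * K := by nlinarith
        gcongr
    _ = 8 / (δ ^ 2 * K) := by field_simp; norm_num

theorem measureReal_le_sum_le (hX : ∀ i, Measurable (X i)) (hindep : iIndepFun X P)
    (h01 : ∀ i ω, X i ω ∈ Set.Icc 0 1) (hμ : ∀ i, P[X i] = μ) {K δ : ℝ} (hK : 0 < K) (hδ : 0 < δ)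
    {s : ℕ} (hsK : s * μ ≤ (1 - δ) * K) :
    P.real {ω | K ≤ ∑ i ∈ range s, X i ω} ≤ 1 / (δ ^ 2 * K) := by
  calc P.real {ω | K ≤ ∑ i ∈ range s, X i ω}
      ≤ P.real {ω | δ * K ≤ |∑ i ∈ range s, X i ω - s * μ|} :=
        measureReal_mono fun ω (hω : K ≤ _) =>
          show δ * K ≤ _ from le_abs.2 (.inl (by linarith))
    _ ≤ s * μ / (δ * K) ^ 2 := measureReal_le_abs_sum_sub_le hX hindep h01 hμ s (by positivity)
    _ ≤ K / (δ * K) ^ 2 := by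
        have : s * μ ≤ K := by nlinarith
        gcongr
    _ = 1 / (δ ^ 2 * K) := by field_simp

theorem exists_nat_mul_le_lt {a μ : ℝ} (ha : 0 ≤ a) (hμ : 0 < μ) :
    ∃ s : ℕ, s * μ ≤ a ∧ a < (s + 1) * μ :=
  ⟨⌊a / μ⌋₊, (le_div_iff₀ hμ).1 (Nat.floor_le (by positivity)),
    (div_lt_iff₀ hμ).1 (Nat.lt_floor_add_one _)⟩

theorem measureReal_not_reachesNear_le (hX : ∀ i, Measurable (X i)) (hindep : iIndepFun X P)
    (h01 : ∀ i ω, X i ω ∈ Set.Icc 0 1) (hμ : ∀ i, P[X i] = μ) (hμ0 : 0 < μ) {K δ : ℝ} (hK : 0 < K)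
    (hδ : 0 < δ) (hδ1 : δ ≤ 1) {T : ℕ} (hT : (1 + δ) * K ≤ T * μ) :
    P.real {ω | ¬ReachesNear K δ μ (X · ω) T} ≤ 9 / (δ ^ 2 * K) := by
  rcases lt_or_ge (δ * K) 2 with hδK | hδK
  · refine measureReal_le_one.trans ((one_le_div (by positivity)).2 ?_)
    nlinarith
  -- Now `μ ≤ 1 ≤ δ / 2 * K`, so a multiple of `μ` lies between `(1 + δ / 2) * K` and `(1 + δ) * K`.
  have hμ1 : μ ≤ 1 := by
    rw [← hμ 0]
    exact (integral_mono (integrable_of_mem_Icc (hX 0) (h01 0)) (integrable_const 1)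
      fun ω => (h01 0 ω).2).trans_eq (by simp)
  obtain ⟨s, hs, hs'⟩ :=
    exists_nat_mul_le_lt (mul_nonneg (sub_nonneg.2 hδ1) hK.le) hμ0
  obtain ⟨r, hr, hr'⟩ := exists_nat_mul_le_lt (a := (1 + δ / 2) * K) (by positivity) hμ0
  have htK : ((r + 1 : ℕ) : ℝ) * μ ≤ (1 + δ) * K := by
    push_cast
    linarith
  have hsT : s < T := by
    exact_mod_cast lt_of_mul_lt_mul_right (show (s : ℝ) * μ < T * μ by nlinarith) hμ0.le
  have hrT : r + 1 ≤ T := by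
    exact_mod_cast le_of_mul_le_mul_right (htK.trans hT) hμ0
  calc P.real {ω | ¬ReachesNear K δ μ (X · ω) T}
      ≤ P.real ({ω | ∑ i ∈ range (r + 1), X i ω < K} ∪ {ω | K ≤ ∑ i ∈ range s, X i ω}) := by
        refine measureReal_mono fun ω hω => ?_
        by_contra! hsum
        obtain ⟨hr_sum, hs_sum⟩ := not_or.1 hsum
        exact hω (reachesNear_of_sum_lt_of_le_sum (fun i => (h01 i ω).1) hμ0.le hsT hs'.le
          (not_le.1 hs_sum) hrT htK (not_lt.1 hr_sum))
    _ ≤ 8 / (δ ^ 2 * K) + 1 / (δ ^ 2 * K) :=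
        (measureReal_union_le _ _).trans (add_le_add
          (measureReal_sum_lt_le hX hindep h01 hμ hK hδ hδ1 (by exact_mod_cast hr'.le) htK)
          (measureReal_le_sum_le hX hindep h01 hμ hK hδ hs))
    _ = 9 / (δ ^ 2 * K) := by rw [← add_div]; norm_num

end IndependentSums

section InfiniteProduct

variable {ι : Type*} {α : ι → Type*} [∀ i, MeasurableSpace (α i)] [∀ i, Countable (α i)]
  [∀ i, MeasurableSingletonClass (α i)] (ν : ∀ i, Measure (α i)) [∀ i, IsProbabilityMeasure (ν i)]

theorem lintegral_infinitePi_apply_of_notMem {β : Type*} {S : (∀ i, α i) → β} {s : Finset ι}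
    (hS : DependsOn S (s : Set ι)) {i : ι} (hi : i ∉ s) (g : β → α i → ℝ≥0∞) :
    ∫⁻ ω, g (S ω) (ω i) ∂Measure.infinitePi ν =
      ∫⁻ ω, ∫⁻ a, g (S ω) a ∂ν i ∂Measure.infinitePi ν := by
  have : Nonempty β := (Measure.infinitePi ν).nonempty_of_neZero.map S
  obtain ⟨S', rfl⟩ := dependsOn_iff_exists_comp.1 hS
  set π : (∀ i, α i) → ∀ j : s, α j := fun ω j => ω j
  have hπ : Measurable π := measurable_pi_lambda _ fun j => measurable_pi_apply _
  have hindep : IndepFun π (Function.eval i) (Measure.infinitePi ν) := by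
    have h := (iIndepFun_infinitePi (P := ν) (X := fun _ a => a) fun _ => measurable_id)
      |>.indepFun_finset s {i} (disjoint_singleton_right.2 hi) measurable_pi_apply
    exact h.comp measurable_id (measurable_pi_apply ⟨i, mem_singleton_self i⟩)
  have hg : Measurable fun p : (∀ j : s, α j) × α i => g (S' p.1) p.2 := measurable_of_countable _
  calc ∫⁻ ω, g (S' (π ω)) (ω i) ∂Measure.infinitePi ν
      = ∫⁻ p, g (S' p.1) p.2 ∂(Measure.infinitePi ν).map fun ω => (π ω, ω i) :=
        (lintegral_map hg (hπ.prodMk (measurable_pi_apply i))).symm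
    _ = ∫⁻ q, ∫⁻ a, g (S' q) a ∂ν i ∂(Measure.infinitePi ν).map π := by
        rw [hindep.map_prod_eq_prod_map_map hπ.aemeasurable (measurable_pi_apply i).aemeasurable,
          (measurePreserving_eval_infinitePi ν i).map_eq, lintegral_prod _ hg.aemeasurable]
    _ = ∫⁻ ω, ∫⁻ a, g (S' (π ω)) a ∂ν i ∂Measure.infinitePi ν :=
        lintegral_map (measurable_of_countable _) hπ

end InfiniteProduct

section Iid

variable {α : Type*} [MeasurableSpace α] (ν : Measure α) [IsProbabilityMeasure ν] {f : α → ℝ}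
  {K : ℝ}

theorem integral_apply_infinitePi (hf : Measurable f) (i : ℕ) :
    ∫ ω, f (ω i) ∂Measure.infinitePi (fun _ : ℕ => ν) = ∫ a, f a ∂ν := by
  have hi := measurePreserving_eval_infinitePi (fun _ : ℕ => ν) i
  exact (integral_map hi.aemeasurable hf.aestronglyMeasurable).symm.trans (by rw [hi.map_eq])

theorem integral_reachTime_infinitePi_mul_le (hf : Measurable f) (h01 : ∀ a, f a ∈ Set.Icc 0 1)
    (hK : 0 ≤ K) (T : ℕ) :
    (∫ ω, (reachTime K (fun i => f (ω i)) T : ℝ) ∂Measure.infinitePi (fun _ : ℕ => ν)) *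
      ∫ a, f a ∂ν ≤ K + 1 :=
  integral_reachTime_mul_le (fun i => hf.comp (measurable_pi_apply i))
    (iIndepFun_infinitePi fun _ => hf) (fun _ _ => h01 _) (integral_apply_infinitePi ν hf) hK T

theorem measureReal_infinitePi_not_reachesNear_le (hf : Measurable f)
    (h01 : ∀ a, f a ∈ Set.Icc 0 1) (hf0 : 0 < ∫ a, f a ∂ν) (hK : 0 < K) {δ : ℝ} (hδ : 0 < δ)
    (hδ1 : δ ≤ 1) {T : ℕ} (hT : (1 + δ) * K ≤ T * ∫ a, f a ∂ν) :
    (Measure.infinitePi fun _ : ℕ => ν).real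
      {ω | ¬ReachesNear K δ (∫ a, f a ∂ν) (fun i => f (ω i)) T} ≤ 9 / (δ ^ 2 * K) :=
  measureReal_not_reachesNear_le (fun i => hf.comp (measurable_pi_apply i))
    (iIndepFun_infinitePi fun _ => hf) (fun _ _ => h01 _) (integral_apply_infinitePi ν hf) hf0 hK
    hδ hδ1 hT

end Iid

section Expectation

variable {α β : Type*}

/-- The expectation of a nonnegative function under a discrete law, without reference to a
σ-algebra. -/
noncomputable def expectation (p : PMF α) (f : α → ℝ≥0∞) : ℝ≥0∞ := ∑' a, p a * f a

theorem expectation_pure (a : α) (f : α → ℝ≥0∞) : expectation (PMF.pure a) f = f a := by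
  rw [expectation, tsum_eq_single a fun b hb => by simp [PMF.pure_apply, hb]]
  simp

theorem expectation_bind (p : PMF α) (k : α → PMF β) (f : β → ℝ≥0∞) :
    expectation (p.bind k) f = expectation p fun a => expectation (k a) f := by
  simp only [expectation, PMF.bind_apply, ← ENNReal.tsum_mul_right, ← ENNReal.tsum_mul_left]
  rw [ENNReal.tsum_comm]
  simp only [mul_assoc]

theorem expectation_map (p : PMF α) (k : α → β) (f : β → ℝ≥0∞) :
    expectation (p.map k) f = expectation p fun a => f (k a) := by
  rw [← PMF.bind_pure_comp, expectation_bind]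
  simp only [Function.comp_apply, expectation_pure]

theorem le_expectation_of_forall_mem_support (p : PMF α) {f : α → ℝ≥0∞} {c : ℝ≥0∞}
    (h : ∀ a ∈ p.support, c ≤ f a) : c ≤ expectation p f := by
  calc c = ∑' a, p a * c := by rw [ENNReal.tsum_mul_right, p.tsum_coe, one_mul]
    _ ≤ expectation p f := ENNReal.tsum_le_tsum fun a => by
        rcases eq_or_ne (p a) 0 with ha | ha
        · simp [ha]
        · exact mul_le_mul_right (h a ha) _

theorem expectation_mono (p : PMF α) {f g : α → ℝ≥0∞} (h : ∀ a, f a ≤ g a) :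
    expectation p f ≤ expectation p g :=
  ENNReal.tsum_le_tsum fun a => mul_le_mul_right (h a) _

theorem toOuterMeasure_eq_expectation (p : PMF α) (s : Set α) :
    p.toOuterMeasure s = expectation p (s.indicator 1) := by
  rw [PMF.toOuterMeasure_apply]
  exact tsum_congr fun a => by by_cases h : a ∈ s <;> simp [h]

variable [MeasurableSpace α]

theorem expectation_eq_lintegral [Countable α] [MeasurableSingletonClass α] (p : PMF α)
    (f : α → ℝ≥0∞) : expectation p f = ∫⁻ a, f a ∂p.toMeasure := by
  rw [lintegral_countable', expectation]
  exact tsum_congr fun a => by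
    rw [PMF.toMeasure_apply_singleton _ _ (measurableSet_singleton a), mul_comm]

theorem integral_comp_of_map_eq_uniformOfFinset [DiscreteMeasurableSpace α] [Finite β]
    {p : PMF α} {k : α → β} {s : Finset β} {hs : s.Nonempty}
    (hk : p.map k = PMF.uniformOfFinset s hs) (f : β → ℝ) :
    ∫ a, f (k a) ∂p.toMeasure = (∑ b ∈ s, f b) / #s := by
  classical
  have := Fintype.ofFinite β
  let _ : MeasurableSpace β := ⊤
  rw [← integral_map (φ := k) Measurable.of_discrete.aemeasurable
      (Measurable.of_discrete (f := f)).aestronglyMeasurable,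
    PMF.toMeasure_map _ _ Measurable.of_discrete, hk, PMF.integral_eq_sum, sum_div,
    ← sum_subset (subset_univ s) fun b _ hb => by simp [hb]]
  exact sum_congr rfl fun b hb => by simp [hb, div_eq_inv_mul]

end Expectation

section Estimator

/-- A running sum of sample values, with the number of terms that were added while the sum was
below a threshold `K`. -/
structure Tally : Type where
  sum : ℝ
  time : ℕ

open Classical in
/-- The tally after one more sample value `x`. -/
noncomputable def Tally.add (K : ℝ) (s : Tally) (x : ℝ) : Tally where
  sum := s.sum + x
  time := if s.sum < K then s.time + 1 else s.time

/-- The tally of the terms `x 0, …, x (T - 1)`. -/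
noncomputable def tallyOf (K : ℝ) (x : ℕ → ℝ) (T : ℕ) : Tally where
  sum := ∑ i ∈ range T, x i
  time := reachTime K x T

theorem tallyOf_succ (K : ℝ) (x : ℕ → ℝ) (T : ℕ) :
    tallyOf K x (T + 1) = (tallyOf K x T).add K (x T) := by
  by_cases h : ∑ i ∈ range T, x i < K
  · simp [tallyOf, Tally.add, sum_range_succ, reachTime_succ_of_lt, h]
  · simp [tallyOf, Tally.add, sum_range_succ, reachTime_succ_of_le (not_lt.1 h), h]

/-- The tallies of the two values sampled in each round of a transcript: the mean inverse degree of
the endpoints of a random edge, and the indicator that a random vertex is not isolated. -/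
noncomputable def tallies (K : ℝ) : Transcript → Tally × Tally
  | .degree _ j :: .vertex _ :: .degree _ l :: .degree _ k :: .edge _ :: h =>
    ((tallies K h).1.add K (((k : ℝ)⁻¹ + (l : ℝ)⁻¹) / 2),
      (tallies K h).2.add K (if j = 0 then 0 else 1))
  | _ => (⟨0, 0⟩, ⟨0, 0⟩)

open Classical in
/-- The move at the end of a round: once both tallies have reached `K`, return the ratio of the
times that this took, and start a new round otherwise. -/
noncomputable def decision (K : ℝ) (h : Transcript) : Query ⊕ ℝ :=
  if K ≤ (tallies K h).1.sum ∧ K ≤ (tallies K h).2.sum then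
    .inr ((tallies K h).1.time / (tallies K h).2.time)
  else .inl .randomEdge

/-- The next move of the estimator. A round consists of a random edge, the degrees of its endpoints,
a random vertex, and its degree. -/
noncomputable def nextMove (K : ℝ) : Transcript → Query ⊕ ℝ
  | .edge e :: _ => .inl (.degree e.inf)
  | .degree _ _ :: .edge e :: _ => .inl (.degree e.sup)
  | .degree _ _ :: .degree _ _ :: _ => .inl .randomVertex
  | .vertex x :: _ => .inl (.degree x)
  | h => decision K h

theorem sym2_inf_mem (e : Sym2 ℕ) : e.inf ∈ e := by
  induction e with | _ a b
  rcases le_total a b with h | h <;> simp [h]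

theorem sym2_sup_mem (e : Sym2 ℕ) : e.sup ∈ e := by
  induction e with | _ a b
  rcases le_total a b with h | h <;> simp [h]

theorem decision_ne_degree (K : ℝ) (h : Transcript) (x : ℕ) :
    decision K h ≠ .inl (.degree x) := by
  unfold decision
  split_ifs <;> simp

theorem mem_seen_of_nextMove_eq {K : ℝ} {h : Transcript} {x : ℕ}
    (hx : nextMove K h = .inl (.degree x)) : x ∈ h.seen := by
  unfold nextMove at hx
  split at hx
  · next e h =>
    cases hx
    exact ⟨.edge e, by simp, sym2_inf_mem e⟩
  · next e h =>
    cases hx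
    exact ⟨.edge e, by simp, sym2_sup_mem e⟩
  · cases hx
  · next y h =>
    cases hx
    exact ⟨.vertex x, by simp, rfl⟩
  · exact absurd hx (decision_ne_degree K h x)

/-- The estimator with threshold `K`. -/
noncomputable def estimator (K : ℝ) : Algorithm where
  next h := PMF.pure (nextMove K h)
  legal _ _ hx := mem_seen_of_nextMove_eq ((PMF.mem_support_pure_iff _ _).1 hx).symm

end Estimator

section Execution

variable {V : Type u} [Fintype V] [Nonempty V] (G : SimpleGraph V) [DecidableRel G.Adj]
  (name : V ↪ ℕ) (hE : G.edgeFinset.Nonempty)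

theorem step_some (A : Algorithm) (h : Transcript) (r : ℝ) :
    step G name hE A (h, some r) = PMF.pure (h, some r) := rfl

/-- The law of the state after `t` further steps from the state `s`. -/
noncomputable def runFrom (A : Algorithm) (s : State) : ℕ → PMF State
  | 0 => PMF.pure s
  | t + 1 => (runFrom A s t).bind (step G name hE A)

theorem run_add (A : Algorithm) (t k : ℕ) :
    run G name hE A (t + k) =
      (run G name hE A t).bind fun s => runFrom G name hE A s k := by
  induction k with
  | zero => exact (PMF.bind_pure _).symm
  | succ k ih => rw [← add_assoc, run, ih, PMF.bind_bind]; rfl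

theorem runFrom_some (A : Algorithm) (h : Transcript) (r : ℝ) (t : ℕ) :
    runFrom G name hE A (h, some r) t = PMF.pure (h, some r) := by
  induction t with
  | zero => rfl
  | succ t ih => rw [runFrom, ih, PMF.pure_bind, step_some]

theorem length_le_of_mem_support_step {A : Algorithm} {s s' : State}
    (hs : s' ∈ (step G name hE A s).support) : s.1.length ≤ s'.1.length := by
  obtain ⟨h, _ | r⟩ := s
  · simp only [step, PMF.mem_support_bind_iff] at hs
    obtain ⟨q | r, -, hs⟩ := hs
    · obtain ⟨e, -, rfl⟩ := (PMF.mem_support_map_iff _ _ _).1 hs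
      simp
    · cases (PMF.mem_support_pure_iff _ _).1 hs
      exact le_rfl
  · cases (PMF.mem_support_pure_iff _ _).1 hs
    exact le_rfl

theorem monotone_expectation_length (A : Algorithm) :
    Monotone fun t => expectation (run G name hE A t) fun s => (s.1.length : ℝ≥0∞) :=
  monotone_nat_of_le_succ fun t => by
    rw [run, expectation_bind]
    exact expectation_mono _ fun s => le_expectation_of_forall_mem_support _ fun s' hs =>
      Nat.cast_le.2 (length_le_of_mem_support_step G name hE hs)

end Execution

section Simulation

/-- The outcome of the two sampling queries of a round. -/
structure Sample (V : Type u) : Type u where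
  edge : Sym2 V
  vertex : V

instance (V : Type u) : MeasurableSpace (Sample V) := ⊤

instance (V : Type u) : DiscreteMeasurableSpace (Sample V) := ⟨fun _ => trivial⟩

instance (V : Type u) [Finite V] : Finite (Sample V) :=
  Finite.of_injective (fun a => (a.edge, a.vertex)) fun ⟨_, _⟩ ⟨_, _⟩ h => by simpa using h

variable {V : Type u} [Fintype V] (G : SimpleGraph V) [DecidableRel G.Adj] (name : V ↪ ℕ)

/-- The mean of the inverse degrees of the endpoints of `e`. -/
noncomputable def meanInvDegree (e : Sym2 V) : ℝ :=
  e.lift ⟨fun u v => ((G.degree u : ℝ)⁻¹ + (G.degree v : ℝ)⁻¹) / 2, fun _ _ =>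
    congrArg (· / 2) (add_comm _ _)⟩

/-- The indicator that `v` is not isolated. -/
noncomputable def nonIsolated (v : V) : ℝ := if G.degree v = 0 then 0 else 1

theorem meanInvDegree_mem_Icc (e : Sym2 V) : meanInvDegree G e ∈ Set.Icc 0 1 := by
  induction e with | _ u v
  have hu := Nat.cast_inv_le_one (α := ℝ) (G.degree u)
  have hv := Nat.cast_inv_le_one (α := ℝ) (G.degree v)
  simp only [meanInvDegree, Sym2.lift_mk]
  exact ⟨by positivity, by linarith⟩

theorem nonIsolated_mem_Icc (v : V) : nonIsolated G v ∈ Set.Icc 0 1 := by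
  unfold nonIsolated
  split_ifs <;> simp

@[simp]
theorem degreeOfName_apply (v : V) : degreeOfName G name (name v) = G.degree v := by
  have h : ∃ w, name w = name v := ⟨v, rfl⟩
  rw [degreeOfName, dif_pos h, name.injective h.choose_spec]

theorem meanInvDegree_eq_inf_sup (e : Sym2 V) :
    ((degreeOfName G name (e.map name).inf : ℝ)⁻¹ +
      (degreeOfName G name (e.map name).sup : ℝ)⁻¹) / 2 = meanInvDegree G e := by
  induction e with | _ u v
  rcases le_total (name u) (name v) with h | h <;> simp [h, meanInvDegree, add_comm]

/-- The transcript `h`, continued by a round in which the sampling queries return `a`. -/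
noncomputable def roundEvents (a : Sample V) (h : Transcript) : Transcript :=
  .degree (name a.vertex) (degreeOfName G name (name a.vertex)) :: .vertex (name a.vertex) ::
    .degree (a.edge.map name).sup (degreeOfName G name (a.edge.map name).sup) ::
    .degree (a.edge.map name).inf (degreeOfName G name (a.edge.map name).inf) ::
    .edge (a.edge.map name) :: h

theorem tallies_roundEvents (K : ℝ) (a : Sample V) (h : Transcript) :
    tallies K (roundEvents G name a h) =
      ((tallies K h).1.add K (meanInvDegree G a.edge),
        (tallies K h).2.add K (nonIsolated G a.vertex)) := by
  rw [roundEvents, tallies, meanInvDegree_eq_inf_sup, degreeOfName_apply, nonIsolated]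

/-- The effect on the state of the estimator of the five steps of a round in which the sampling
queries return `a`. -/
noncomputable def playRound (K : ℝ) (a : Sample V) : State → State
  | (h, some r) => (h, some r)
  | (h, none) =>
    match decision K h with
    | .inl _ => (roundEvents G name a h, none)
    | .inr r => (h, some r)

/-- The state of the estimator after `T` rounds in which the sampling queries return the terms
of `ω`. -/
noncomputable def simulate (K : ℝ) (ω : ℕ → Sample V) : ℕ → State
  | 0 => ([], none)
  | T + 1 => playRound G name K (ω T) (simulate K ω T)

theorem dependsOn_simulate (K : ℝ) (T : ℕ) :
    DependsOn (fun ω => simulate G name K ω T) (range T : Set ℕ) := by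
  induction T with
  | zero => exact fun _ _ _ => rfl
  | succ T ih =>
    intro ω ω' h
    simp only [coe_range, Set.mem_Iio, Order.lt_add_one_iff] at h
    simp only [simulate]
    rw [h T le_rfl, show simulate G name K ω T = _ from ih fun i hi => h i (mem_range.1 hi).le]

/-- The inverse degrees sampled in the rounds `ω`. -/
noncomputable def edgeValues (ω : ℕ → Sample V) (i : ℕ) : ℝ := meanInvDegree G (ω i).edge

/-- The indicators of non-isolated vertices sampled in the rounds `ω`. -/
noncomputable def vertexValues (ω : ℕ → Sample V) (i : ℕ) : ℝ := nonIsolated G (ω i).vertex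

theorem measurable_edgeValues (i : ℕ) : Measurable fun ω => edgeValues G ω i :=
  (Measurable.of_discrete (f := fun a : Sample V => meanInvDegree G a.edge)).comp
    (measurable_pi_apply i)

theorem measurable_vertexValues (i : ℕ) : Measurable fun ω => vertexValues G ω i :=
  (Measurable.of_discrete (f := fun a : Sample V => nonIsolated G a.vertex)).comp
    (measurable_pi_apply i)

/-- Both sampled values have reached the sum `K` within `T` rounds. -/
def Finished (K : ℝ) (ω : ℕ → Sample V) (T : ℕ) : Prop :=
  K ≤ ∑ i ∈ range T, edgeValues G ω i ∧ K ≤ ∑ i ∈ range T, vertexValues G ω i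

/-- The output of the estimator once it is finished. -/
noncomputable def estimate (K : ℝ) (ω : ℕ → Sample V) (T : ℕ) : ℝ :=
  reachTime K (edgeValues G ω) T / reachTime K (vertexValues G ω) T

variable {G} in
theorem Finished.succ {K : ℝ} {ω : ℕ → Sample V} {T : ℕ} (h : Finished G K ω T) :
    Finished G K ω (T + 1) :=
  ⟨h.1.trans (monotone_sum_range (fun _ => (meanInvDegree_mem_Icc G _).1) T.le_succ),
    h.2.trans (monotone_sum_range (fun _ => (nonIsolated_mem_Icc G _).1) T.le_succ)⟩

variable {G} in
theorem Finished.estimate_succ {K : ℝ} {ω : ℕ → Sample V} {T : ℕ} (h : Finished G K ω T) :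
    estimate G K ω (T + 1) = estimate G K ω T := by
  rw [estimate, estimate, reachTime_succ_of_le h.1, reachTime_succ_of_le h.2]

theorem decision_of_finished {K : ℝ} {ω : ℕ → Sample V} {T : ℕ} {h : Transcript}
    (hh : tallies K h = (tallyOf K (edgeValues G ω) T, tallyOf K (vertexValues G ω) T))
    (hT : Finished G K ω T) : decision K h = .inr (estimate G K ω T) := by
  rw [decision, hh]
  exact if_pos hT

theorem decision_of_not_finished {K : ℝ} {ω : ℕ → Sample V} {T : ℕ} {h : Transcript}
    (hh : tallies K h = (tallyOf K (edgeValues G ω) T, tallyOf K (vertexValues G ω) T))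
    (hT : ¬Finished G K ω T) : decision K h = .inl .randomEdge := by
  rw [decision, hh]
  exact if_neg hT

theorem simulate_cases (K : ℝ) (ω : ℕ → Sample V) (T : ℕ) :
    (∃ h, simulate G name K ω T = (h, none) ∧ nextMove K h = decision K h ∧
        tallies K h = (tallyOf K (edgeValues G ω) T, tallyOf K (vertexValues G ω) T)) ∨
      Finished G K ω T ∧ ∃ h, simulate G name K ω T = (h, some (estimate G K ω T)) := by
  induction T with
  | zero => exact .inl ⟨[], rfl, rfl, by simp [tallies, tallyOf, reachTime]⟩
  | succ T ih =>
    rcases ih with ⟨h, hsim, -, hh⟩ | ⟨hT, h, hsim⟩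
    · by_cases hT : Finished G K ω T
      · refine .inr ⟨hT.succ, h, ?_⟩
        simp only [simulate, hsim, playRound, decision_of_finished G hh hT, hT.estimate_succ]
      · refine .inl ⟨roundEvents G name (ω T) h, ?_, rfl, ?_⟩
        · simp only [simulate, hsim, playRound, decision_of_not_finished G hh hT]
        · rw [tallies_roundEvents, hh, tallyOf_succ, tallyOf_succ, edgeValues, vertexValues]
    · exact .inr ⟨hT.succ, h, by simp only [simulate, hsim, playRound, hT.estimate_succ]⟩

theorem simulate_succ_of_finished {K : ℝ} {ω : ℕ → Sample V} {T : ℕ} (hT : Finished G K ω T) :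
    (simulate G name K ω (T + 1)).2 = some (estimate G K ω T) := by
  rcases simulate_cases G name K ω T with ⟨h, hsim, -, hh⟩ | ⟨-, h, hsim⟩
  · simp only [simulate, hsim, playRound, decision_of_finished G hh hT]
  · simp only [simulate, hsim, playRound]

theorem length_simulate_le (K : ℝ) (ω : ℕ → Sample V) (T : ℕ) :
    (simulate G name K ω T).1.length ≤
      5 * (reachTime K (edgeValues G ω) T + reachTime K (vertexValues G ω) T) := by
  induction T with
  | zero => simp [simulate]
  | succ T ih =>
    have hx : reachTime K (edgeValues G ω) T ≤ reachTime K (edgeValues G ω) (T + 1) :=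
      Nat.count_monotone _ T.le_succ
    have hy : reachTime K (vertexValues G ω) T ≤ reachTime K (vertexValues G ω) (T + 1) :=
      Nat.count_monotone _ T.le_succ
    rcases simulate_cases G name K ω T with ⟨h, hsim, -, hh⟩ | ⟨-, h, hsim⟩
    · by_cases hT : Finished G K ω T
      · simp only [simulate, hsim, playRound, decision_of_finished G hh hT] at ih ⊢
        omega
      · simp only [simulate, hsim, playRound, decision_of_not_finished G hh hT, roundEvents,
          List.length_cons] at ih ⊢
        rcases not_and_or.1 hT with hK | hK
        · rw [reachTime_succ_of_lt (not_le.1 hK)]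
          omega
        · rw [reachTime_succ_of_lt (not_le.1 hK)]
          omega
    · simp only [simulate, hsim, playRound] at ih ⊢
      omega

section Law

variable [Nonempty V] (hE : G.edgeFinset.Nonempty)

/-- The law of the outcome of the two sampling queries of a round. -/
noncomputable def sample : PMF (Sample V) :=
  (PMF.uniformOfFinset G.edgeFinset hE).bind fun e => (PMF.uniformOfFintype V).map fun v => ⟨e, v⟩

/-- The law of the outcomes of infinitely many independent rounds. -/
noncomputable def roundsLaw : Measure (ℕ → Sample V) :=
  Measure.infinitePi fun _ => (sample G hE).toMeasure

instance : IsProbabilityMeasure (roundsLaw G hE) :=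
  inferInstanceAs (IsProbabilityMeasure (Measure.infinitePi _))

theorem map_edge_sample :
    (sample G hE).map Sample.edge = PMF.uniformOfFinset G.edgeFinset hE := by
  simp only [sample, PMF.map_bind, PMF.map_comp, Function.comp_def]
  exact (congrArg _ (funext fun e => PMF.map_const _ e)).trans (PMF.bind_pure _)

theorem map_vertex_sample : (sample G hE).map Sample.vertex = PMF.uniformOfFintype V := by
  simp only [sample, PMF.map_bind, PMF.map_comp, Function.comp_def]
  exact (PMF.bind_const _ _).trans (PMF.map_id _)

theorem step_estimator_inr {K : ℝ} {h : Transcript} {r : ℝ} (hr : nextMove K h = .inr r) :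
    step G name hE (estimator K) (h, none) = PMF.pure (h, some r) := by
  simp [step, estimator, hr]

theorem step_estimator_inl {K : ℝ} {h : Transcript} {q : Query} (hq : nextMove K h = .inl q) :
    step G name hE (estimator K) (h, none) =
      (answer G name hE q).map fun e => (e :: h, none) := by
  simp [step, estimator, hq]

theorem step_estimator_degree {K : ℝ} {h : Transcript} {x : ℕ}
    (hx : nextMove K h = .inl (.degree x)) :
    step G name hE (estimator K) (h, none) =
      PMF.pure (.degree x (degreeOfName G name x) :: h, none) := by
  rw [step_estimator_inl G name hE hx, answer, PMF.pure_map]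

theorem runFrom_estimator_five {K : ℝ} {h : Transcript} (hh : nextMove K h = decision K h) :
    runFrom G name hE (estimator K) (h, none) 5 =
      (sample G hE).map fun a => playRound G name K a (h, none) := by
  by_cases hK : K ≤ (tallies K h).1.sum ∧ K ≤ (tallies K h).2.sum
  · have hd : decision K h = .inr ((tallies K h).1.time / (tallies K h).2.time) := if_pos hK
    simp only [runFrom, PMF.pure_bind, step_estimator_inr G name hE (hh.trans hd), step_some,
      playRound, hd]
    exact (PMF.map_const _ _).symm
  · have hd : decision K h = .inl .randomEdge := if_neg hK
    simp only [runFrom, PMF.pure_bind, step_estimator_inl G name hE (hh.trans hd), answer, sample,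
      PMF.map_bind, PMF.map_comp, PMF.bind_map, PMF.bind_bind, playRound, hd]
    congr 1
    funext e
    simp only [Function.comp_apply]
    rw [step_estimator_degree G name hE (x := (e.map name).inf) rfl, PMF.pure_bind,
      step_estimator_degree G name hE (x := (e.map name).sup) rfl, PMF.pure_bind,
      step_estimator_inl G name hE (q := .randomVertex) rfl, answer, PMF.map_comp, PMF.bind_map,
      ← PMF.bind_pure_comp]
    congr 1
    funext v
    exact step_estimator_degree G name hE rfl

theorem runFrom_simulate_five (K : ℝ) (ω : ℕ → Sample V) (T : ℕ) :
    runFrom G name hE (estimator K) (simulate G name K ω T) 5 =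
      (sample G hE).map fun a => playRound G name K a (simulate G name K ω T) := by
  rcases simulate_cases G name K ω T with ⟨h, hsim, hnext, -⟩ | ⟨-, h, hsim⟩
  · rw [hsim, runFrom_estimator_five G name hE hnext]
  · rw [hsim, runFrom_some]
    exact (PMF.map_const _ _).symm

theorem expectation_run_five_mul (K : ℝ) (T : ℕ) (f : State → ℝ≥0∞) :
    expectation (run G name hE (estimator K) (5 * T)) f =
      ∫⁻ ω, f (simulate G name K ω T) ∂roundsLaw G hE := by
  induction T generalizing f with
  | zero => simp [run, expectation_pure, simulate]
  | succ T ih =>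
    rw [mul_add, run_add, expectation_bind, ih]
    simp only [mul_one, runFrom_simulate_five, expectation_map, expectation_eq_lintegral]
    exact (lintegral_infinitePi_apply_of_notMem _ (dependsOn_simulate G name K T)
      notMem_range_self fun s a => f (playRound G name K a s)).symm

end Law

end Simulation

section Means

variable {V : Type u} [Fintype V] (G : SimpleGraph V) [DecidableRel G.Adj]

theorem sum_edgeFinset_sum_toFinset [DecidableEq V] (f : V → ℝ) :
    ∑ e ∈ G.edgeFinset, ∑ v ∈ e.toFinset, f v = ∑ v, G.degree v * f v := by
  calc ∑ e ∈ G.edgeFinset, ∑ v ∈ e.toFinset, f v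
      = ∑ v, ∑ _ ∈ G.incidenceFinset v, f v := sum_comm' fun _ _ => by
        simp [G.incidenceFinset_eq_filter]
    _ = ∑ v, G.degree v * f v := by simp

theorem sum_nonIsolated : ∑ v, nonIsolated G v = numNonIsolated G := by
  rw [numNonIsolated, card_filter]
  push_cast
  exact sum_congr rfl fun v _ => by simp [nonIsolated]

theorem sum_meanInvDegree :
    ∑ e ∈ G.edgeFinset, meanInvDegree G e = numNonIsolated G / 2 := by
  classical
  have hpair : ∀ e ∈ G.edgeFinset,
      meanInvDegree G e = (∑ v ∈ e.toFinset, (G.degree v : ℝ)⁻¹) / 2 := by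
    refine Sym2.ind fun u v he => ?_
    have huv : u ≠ v := (G.mem_edgeFinset.1 he).ne
    rw [Sym2.toFinset_mk_eq, sum_pair huv, meanInvDegree, Sym2.lift_mk]
  have hinv : ∀ v, G.degree v * (G.degree v : ℝ)⁻¹ = nonIsolated G v := fun v => by
    unfold nonIsolated
    split_ifs with h <;> simp [h]
  rw [sum_congr rfl hpair, ← sum_div, sum_edgeFinset_sum_toFinset, ← sum_nonIsolated]
  simp only [hinv]

variable {G} in
theorem numNonIsolated_pos (hE : G.edgeFinset.Nonempty) : 0 < numNonIsolated G := by
  obtain ⟨e, he⟩ := hE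
  induction e with | _ u v
  have huv : G.Adj u v := G.mem_edgeFinset.1 he
  exact card_pos.2 ⟨u, mem_filter.2 ⟨mem_univ u, (G.degree_pos_iff_exists_adj u).2 ⟨v, huv⟩ |>.ne'⟩⟩

variable [Nonempty V] (hE : G.edgeFinset.Nonempty)

theorem integral_meanInvDegree :
    ∫ a, meanInvDegree G a.edge ∂(sample G hE).toMeasure =
      numNonIsolated G / (2 * #G.edgeFinset) := by
  rw [integral_comp_of_map_eq_uniformOfFinset (map_edge_sample G hE), sum_meanInvDegree, div_div]

theorem integral_nonIsolated :
    ∫ a, nonIsolated G a.vertex ∂(sample G hE).toMeasure =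
      numNonIsolated G / Fintype.card V := by
  rw [integral_comp_of_map_eq_uniformOfFinset (map_vertex_sample G hE), sum_nonIsolated, card_univ]

end Means

section Guarantee

theorem div_mem_approximations {K ε a b x y : ℝ} (hε0 : 0 < ε) (hε1 : ε ≤ 1) (hK : 0 < K)
    (hx : 0 < x) (hb0 : 0 ≤ b) (ha : |a * x - K| ≤ ε / 3 * K) (hb : |b * y - K| ≤ ε / 3 * K) :
    a / b ∈ approximations ε (y / x) := by
  obtain ⟨ha_lower, ha_upper⟩ := abs_le.1 ha
  obtain ⟨hb_lower, hb_upper⟩ := abs_le.1 hb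
  have hεK : ε * (ε * K) ≤ ε * K := mul_le_of_le_one_left (by positivity) hε1
  have hb_pos : 0 < b := by
    refine hb0.lt_of_ne fun h => ?_
    rw [← h] at hb_lower
    nlinarith
  constructor
  · rw [← mul_div_assoc, div_le_div_iff₀ hx hb_pos]
    nlinarith [mul_le_mul_of_nonneg_left hb_upper (sub_nonneg.2 hε1)]
  · rw [← mul_div_assoc, div_le_div_iff₀ hb_pos hx]
    nlinarith [mul_le_mul_of_nonneg_left hb_lower (by linarith : 0 ≤ 1 + ε)]

variable {V : Type u} [Fintype V] (G : SimpleGraph V) [DecidableRel G.Adj]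

/-- The rounds `ω` are typical: within `T` of them both sampled values reach the sum `K`, at times
close to the quotients of `K` by their means. -/
def Typical (K δ : ℝ) (T : ℕ) (ω : ℕ → Sample V) : Prop :=
  ReachesNear K δ (numNonIsolated G / (2 * #G.edgeFinset)) (edgeValues G ω) T ∧
    ReachesNear K δ (numNonIsolated G / Fintype.card V) (vertexValues G ω) T

theorem measurableSet_typical (K δ : ℝ) (T : ℕ) : MeasurableSet {ω | Typical G K δ T ω} :=
  (measurableSet_reachesNear (measurable_edgeValues G) ..).inter
    (measurableSet_reachesNear (measurable_vertexValues G) ..)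

theorem estimate_mem_approximations [Nonempty V] (hE : G.edgeFinset.Nonempty) {K ε : ℝ}
    (hε0 : 0 < ε) (hε1 : ε ≤ 1) (hK : 0 < K) {T : ℕ} {ω : ℕ → Sample V}
    (hω : Typical G K (ε / 3) T ω) :
    estimate G K ω T ∈ approximations ε (avgDegree G) := by
  have hn := numNonIsolated_pos hE
  have hd : avgDegree G =
      (numNonIsolated G / Fintype.card V : ℝ) / (numNonIsolated G / (2 * #G.edgeFinset)) := by
    rw [avgDegree]
    field_simp
  rw [hd]
  exact div_mem_approximations hε0 hε1 hK (by positivity) (Nat.cast_nonneg _) hω.1.2 hω.2.2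

variable [Nonempty V] (name : V ↪ ℕ) (hE : G.edgeFinset.Nonempty) {K : ℝ}

theorem integral_reachTime_edgeValues_le (hK : 0 ≤ K) (T : ℕ) :
    ∫ ω, (reachTime K (edgeValues G ω) T : ℝ) ∂roundsLaw G hE ≤
      (K + 1) * (2 * #G.edgeFinset / numNonIsolated G) := by
  have hn := numNonIsolated_pos hE
  have h := integral_reachTime_infinitePi_mul_le (sample G hE).toMeasure Measurable.of_discrete
    (fun a : Sample V => meanInvDegree_mem_Icc G a.edge) hK T
  rw [integral_meanInvDegree] at h
  rw [← inv_div, ← div_eq_mul_inv, le_div_iff₀ (by positivity)]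
  exact h

theorem integral_reachTime_vertexValues_le (hK : 0 ≤ K) (T : ℕ) :
    ∫ ω, (reachTime K (vertexValues G ω) T : ℝ) ∂roundsLaw G hE ≤
      (K + 1) * (Fintype.card V / numNonIsolated G) := by
  have hn := numNonIsolated_pos hE
  have h := integral_reachTime_infinitePi_mul_le (sample G hE).toMeasure Measurable.of_discrete
    (fun a : Sample V => nonIsolated_mem_Icc G a.vertex) hK T
  rw [integral_nonIsolated] at h
  rw [← inv_div, ← div_eq_mul_inv, le_div_iff₀ (by positivity)]
  exact h

theorem expectation_length_run_le (hK : 0 ≤ K) (T : ℕ) :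
    expectation (run G name hE (estimator K) (5 * T)) (fun s => (s.1.length : ℝ≥0∞)) ≤
      ENNReal.ofReal (5 * ((K + 1) * (2 * #G.edgeFinset / numNonIsolated G) +
        (K + 1) * (Fintype.card V / numNonIsolated G))) := by
  have hx : Integrable (fun ω => (reachTime K (edgeValues G ω) T : ℝ)) (roundsLaw G hE) :=
    integrable_reachTime (measurable_edgeValues G) K T
  have hy : Integrable (fun ω => (reachTime K (vertexValues G ω) T : ℝ)) (roundsLaw G hE) :=
    integrable_reachTime (measurable_vertexValues G) K T
  calc expectation (run G name hE (estimator K) (5 * T)) (fun s => (s.1.length : ℝ≥0∞))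
      = ∫⁻ ω, (simulate G name K ω T).1.length ∂roundsLaw G hE := expectation_run_five_mul ..
    _ ≤ ∫⁻ ω, ENNReal.ofReal (5 * (reachTime K (edgeValues G ω) T +
          reachTime K (vertexValues G ω) T)) ∂roundsLaw G hE := lintegral_mono fun ω => by
        rw [ENNReal.le_ofReal_iff_toReal_le (by simp) (by positivity), ENNReal.toReal_natCast]
        exact_mod_cast length_simulate_le G name K ω T
    _ = ENNReal.ofReal (∫ ω, 5 * (reachTime K (edgeValues G ω) T +
          reachTime K (vertexValues G ω) T : ℝ) ∂roundsLaw G hE) :=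
        (ofReal_integral_eq_lintegral_ofReal ((hx.add hy).const_mul 5)
          (ae_of_all _ fun ω => by simp only [Pi.add_apply]; positivity)).symm
    _ = ENNReal.ofReal (5 * (∫ ω, (reachTime K (edgeValues G ω) T : ℝ) ∂roundsLaw G hE +
          ∫ ω, (reachTime K (vertexValues G ω) T : ℝ) ∂roundsLaw G hE)) := by
        rw [integral_const_mul, integral_add hx hy]
    _ ≤ _ := by
        gcongr
        · exact integral_reachTime_edgeValues_le G hE hK T
        · exact integral_reachTime_vertexValues_le G hE hK T

theorem expectedQueries_estimator_le (hK : 0 ≤ K) :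
    expectedQueries G name hE (estimator K) ≤
      ENNReal.ofReal (5 * ((K + 1) * (2 * #G.edgeFinset / numNonIsolated G) +
        (K + 1) * (Fintype.card V / numNonIsolated G))) :=
  iSup_le fun t =>
    (monotone_expectation_length G name hE _ (Nat.le_mul_of_pos_left t (by norm_num))).trans
      (expectation_length_run_le G name hE hK t)

theorem exists_measureReal_not_typical_le (hK : 0 < K) {δ : ℝ} (hδ : 0 < δ) (hδ1 : δ ≤ 1) :
    ∃ T, (roundsLaw G hE).real {ω | ¬Typical G K δ T ω} ≤ 18 / (δ ^ 2 * K) := by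
  have hn := numNonIsolated_pos hE
  set μx : ℝ := numNonIsolated G / (2 * #G.edgeFinset) with hμx
  set μy : ℝ := numNonIsolated G / Fintype.card V with hμy
  have hμx0 : 0 < μx := by positivity
  have hμy0 : 0 < μy := by positivity
  obtain ⟨T, hT⟩ := exists_nat_ge (max ((1 + δ) * K / μx) ((1 + δ) * K / μy))
  have hTx : (1 + δ) * K ≤ T * μx := (div_le_iff₀ hμx0).1 ((le_max_left _ _).trans hT)
  have hTy : (1 + δ) * K ≤ T * μy := (div_le_iff₀ hμy0).1 ((le_max_right _ _).trans hT)
  rw [hμx, ← integral_meanInvDegree G hE] at hμx0 hTx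
  rw [hμy, ← integral_nonIsolated G hE] at hμy0 hTy
  have hx := measureReal_infinitePi_not_reachesNear_le _ Measurable.of_discrete
    (fun a : Sample V => meanInvDegree_mem_Icc G a.edge) hμx0 hK hδ hδ1 hTx
  have hy := measureReal_infinitePi_not_reachesNear_le _ Measurable.of_discrete
    (fun a : Sample V => nonIsolated_mem_Icc G a.vertex) hμy0 hK hδ hδ1 hTy
  rw [integral_meanInvDegree] at hx
  rw [integral_nonIsolated] at hy
  refine ⟨T, ?_⟩
  calc (roundsLaw G hE).real {ω | ¬Typical G K δ T ω}
      ≤ (roundsLaw G hE).real ({ω | ¬ReachesNear K δ μx (edgeValues G ω) T} ∪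
          {ω | ¬ReachesNear K δ μy (vertexValues G ω) T}) :=
        measureReal_mono fun ω hω => not_and_or.1 hω
    _ ≤ 9 / (δ ^ 2 * K) + 9 / (δ ^ 2 * K) := (measureReal_union_le _ _).trans (add_le_add hx hy)
    _ = 18 / (δ ^ 2 * K) := by rw [← add_div]; norm_num

theorem le_outputProb_estimator {ε : ℝ} (hε0 : 0 < ε) (hε1 : ε ≤ 1) (hK : 0 < K) :
    ENNReal.ofReal (1 - 18 / ((ε / 3) ^ 2 * K)) ≤
      outputProb G name hE (estimator K) (approximations ε (avgDegree G)) := by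
  obtain ⟨T, hT⟩ := exists_measureReal_not_typical_le G hE hK (by positivity : 0 < ε / 3)
    (by linarith)
  set S : Set State := {s | ∃ r ∈ approximations ε (avgDegree G), s.2 = some r}
  have hmem : ∀ ω, Typical G K (ε / 3) T ω → simulate G name K ω (T + 1) ∈ S := fun ω hω =>
    ⟨_, estimate_mem_approximations G hE hε0 hε1 hK hω,
      simulate_succ_of_finished G name ⟨hω.1.1, hω.2.1⟩⟩
  calc ENNReal.ofReal (1 - 18 / ((ε / 3) ^ 2 * K))
      ≤ ENNReal.ofReal ((roundsLaw G hE).real {ω | Typical G K (ε / 3) T ω}) := by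
        have := probReal_compl_eq_one_sub (μ := roundsLaw G hE)
          (measurableSet_typical G K (ε / 3) T)
        rw [Set.compl_ofPred] at this
        exact ENNReal.ofReal_le_ofReal (by linarith)
    _ = ∫⁻ ω, {ω | Typical G K (ε / 3) T ω}.indicator 1 ω ∂roundsLaw G hE := by
        rw [ofReal_measureReal, lintegral_indicator_one (measurableSet_typical G K _ T)]
    _ ≤ ∫⁻ ω, S.indicator 1 (simulate G name K ω (T + 1)) ∂roundsLaw G hE :=
        lintegral_mono (Set.indicator_le (M := ℝ≥0∞)
          fun ω hω => (Set.indicator_of_mem (hmem ω hω) (1 : State → ℝ≥0∞)).ge)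
    _ = (run G name hE (estimator K) (5 * (T + 1))).toOuterMeasure S := by
        rw [toOuterMeasure_eq_expectation, expectation_run_five_mul]
    _ ≤ outputProb G name hE (estimator K) (approximations ε (avgDegree G)) :=
        le_iSup (fun t => (run G name hE (estimator K) t).toOuterMeasure S) _

end Guarantee

section LogLog

theorem logLog_nonneg (x : ℝ) : 0 ≤ logLog x :=
  Real.log_nonneg (le_max_left _ _)

theorem one_le_logLog {x : ℝ} (hx : Real.exp (Real.exp 1) ≤ x) : 1 ≤ logLog x := by
  have hlog : Real.exp 1 ≤ Real.log (max 1 x) :=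
    (Real.le_log_iff_exp_le (by positivity)).2 (hx.trans (le_max_right _ _))
  exact (Real.le_log_iff_exp_le (by positivity)).2 (hlog.trans (le_max_right _ _))

theorem card_edgeFinset_add_card_le {V : Type u} [Fintype V] [Nonempty V] (G : SimpleGraph V)
    [DecidableRel G.Adj] :
    (#G.edgeFinset + Fintype.card V : ℝ) ≤ (1 + Real.exp (Real.exp 1)) *
      (#G.edgeFinset * logLog (avgDegree G) + Fintype.card V) := by
  have hn : (0 : ℝ) < Fintype.card V := Nat.cast_pos.2 Fintype.card_pos
  have hexp := Real.exp_pos (Real.exp 1)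
  have hmlog : (0 : ℝ) ≤ #G.edgeFinset * logLog (avgDegree G) :=
    mul_nonneg (Nat.cast_nonneg _) (logLog_nonneg _)
  rcases le_total (Real.exp (Real.exp 1)) (avgDegree G) with hd | hd
  · have := le_mul_of_one_le_right (Nat.cast_nonneg #G.edgeFinset) (one_le_logLog hd)
    nlinarith
  · rw [avgDegree, div_le_iff₀ hn] at hd
    have := Nat.cast_nonneg (α := ℝ) #G.edgeFinset
    nlinarith

end LogLog

end EdgeCount

open EdgeCount Finset in
theorem mainTheorem10_general :
    ∃ C : ℝ, 0 < C ∧ ∃ A : ℝ → Algorithm, ∀ ε : ℝ, 0 < ε → ε ≤ 1 →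
      ∀ (V : Type u) [Fintype V] [Nonempty V] (G : SimpleGraph V) [DecidableRel G.Adj]
        (name : V ↪ ℕ) (hE : G.edgeFinset.Nonempty),
        2 / 3 ≤ outputProb G name hE (A ε) (approximations ε (avgDegree G)) ∧
        expectedQueries G name hE (A ε) ≤
          ENNReal.ofReal (C * ((#G.edgeFinset + Fintype.card V) / (numNonIsolated G * ε ^ 2))) := by
  refine ⟨4870, by norm_num, fun ε => estimator (486 / ε ^ 2), fun ε hε0 hε1 V _ _ G _ name hE =>
    ⟨?_, ?_⟩⟩
  · refine le_trans ?_ (le_outputProb_estimator G name hE hε0 hε1 (by positivity))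
    rw [show 1 - 18 / ((ε / 3) ^ 2 * (486 / ε ^ 2)) = 2 / 3 by field_simp; norm_num]
    simp [ENNReal.ofReal_div_of_pos]
  · refine (expectedQueries_estimator_le G name hE (by positivity)).trans
      (ENNReal.ofReal_le_ofReal ?_)
    have hn := numNonIsolated_pos hE
    have hK : 486 / ε ^ 2 + 1 ≤ 487 / ε ^ 2 := by
      rw [div_add_one (by positivity)]
      gcongr
      nlinarith
    calc _ ≤ 5 * (487 / ε ^ 2 * (2 * #G.edgeFinset / numNonIsolated G) +
          487 / ε ^ 2 * (2 * Fintype.card V / numNonIsolated G)) := by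
          gcongr
          linarith
      _ = 4870 * ((#G.edgeFinset + Fintype.card V) / (numNonIsolated G * ε ^ 2)) := by
          field_simp
          ring

theorem mainTheorem10 :
    ∃ C : ℝ, 0 < C ∧ ∃ A : ℝ → EdgeCount.Algorithm,
      ∀ ε : ℝ, 0 < ε → ε < 1 →
      ∀ (V : Type u) [Fintype V] [DecidableEq V] [Nonempty V]
        (G : SimpleGraph V) [DecidableRel G.Adj] (name : V ↪ ℕ) (hE : G.edgeFinset.Nonempty),
        2 / 3 ≤ EdgeCount.outputProb G name hE (A ε)
            (EdgeCount.approximations ε (EdgeCount.avgDegree G)) ∧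
        EdgeCount.expectedQueries G name hE (A ε) ≤
          ENNReal.ofReal (C *
            ((G.edgeFinset.card : ℝ) * EdgeCount.logLog (EdgeCount.avgDegree G) /
                ((EdgeCount.numNonIsolated G : ℝ) * ε ^ 2) +
              (Fintype.card V : ℝ) / ((EdgeCount.numNonIsolated G : ℝ) * ε ^ 2))) := by
  obtain ⟨C, hC, A, hA⟩ := mainTheorem10_general
  refine ⟨C * (1 + Real.exp (Real.exp 1)), by positivity, A,
    fun ε hε0 hε1 V _ _ _ G _ name hE => ?_⟩
  obtain ⟨hprob, hqueries⟩ := hA ε hε0 hε1.le V G name hE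
  refine ⟨hprob, hqueries.trans (ENNReal.ofReal_le_ofReal ?_)⟩
  rw [← add_div, mul_assoc, ← mul_div_assoc (1 + _)]
  gcongr
  exact EdgeCount.card_edgeFinset_add_card_le G
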